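/- **Corollary (converse part of i.i.d. pure-state conversion).** Let $\mathcal H,\mathcal H'$ be complex Hilbert spaces with (possibly unbounded) self-adjoint Hamiltonians $H$ and $H'$, and let $\psi\in\mathcal H$, $\phi\in\mathcal H'$ be unit vectors in the domains of $H$ and $H'$ (so that the variances below are finite). Assume that the pure states $\psi$ and $\phi$ have period $2\pi$, i.e. $\inf\{t>0 : |\langle\psi|e^{-iHt}|\psi\rangle|=1\}=2\pi$, and likewise for $(\phi,H')$. For $k\ge 0$ put $H_{\mathrm{iid},k}=\sum_{j=1}^k I^{\otimes (j-1)}\otimes H\otimes I^{\otimes (k-j)}$, and define $H'_{\mathrm{iid},k}$ in the same way from $H'$. Let $R>0$, and suppose that the sequence $\{\psi^{\otimes m}\}_m$ with Hamiltonians $\{H_{\mathrm{iid},m}\}_m$ is asymptotically convertible by covariant operations to the sequence $\{\phi^{\otimes\lceil Rm\rceil}\}_m$ with Hamiltonians $\{H'_{\mathrm{iid},\lceil Rm\rceil}\}_m$. That is, for every $\epsilon\in(0,1]$ there are quantum channels (completely positive trace-preserving maps) $\mathcal E_m$ with $$\mathcal E_m\big(e^{-iH_{\mathrm{iid},m}t}\rho\,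 e^{iH_{\mathrm{iid},m}t}\big)=e^{-iH'_{\mathrm{iid},\lceil Rm\rceil}t}\,\mathcal E_m(\rho)\,e^{iH'_{\mathrm{iid},\lceil Rm\rceil}t}\qquad\text{for all states }\rho\text{ and all }t\in\mathbb R,$$ such that $\limsup_{m\to\infty}\tfrac12\big\|\mathcal E_m(\psi^{\otimes m})-\phi^{\otimes\lceil Rm\rceil}\big\|_1\le\epsilon$. Then $\mathrm{Var}(\phi,H')>0$, $\mathcal F(\phi,H')>0$, $$\mathrm{Var}(\psi,H)\ \ge\ R\,\mathrm{Var}(\phi,H'),\qquad\text{i.e.}\qquad R\ \le\ \frac{\mathrm{Var}(\psi,H)}{\mathrm{Var}(\phi,H')}=\frac{\mathcal F(\psi,H)}{\mathcal F(\phi,H')}.$$ Here $\mathrm{Var}(\psi,H)=\langle\psi|H^2|\psi\rangle-\langle\psi|H|\psi\rangle^2$, and $\mathcal F(\rho,H)=2\sum_{i,j}\frac{(\lambda_i-\lambda_j)^2}{\lambda_i+\lambda_j}|\langle i|H|j\rangle|^2$ (terms with $\lambda_i=\lambda_j=0$ omitted), for an eigenvalue decomposition $\rho=\sum_i\lambda_i|i\rangle\langle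 i|$, is the SLD quantum Fisher information; a unit vector stands for its rank-one projection. -/

import Mathlib

open scoped TensorProduct

noncomputable section

namespace Asymmetry

universe u v

/-! ### Hilbert space tensor powers -/

/-- A bundled complex Hilbert space (used only to define tensor powers by recursion). -/
structure HilbertSpaceObj : Type (u + 1) where
  carrier : Type u
  [normed : NormedAddCommGroup carrier]
  [inner : InnerProductSpace ℂ carrier]
  [complete : CompleteSpace carrier]

attribute [instance] HilbertSpaceObj.normed HilbertSpaceObj.inner HilbertSpaceObj.complete

/-- The tensor powers of `E`: the zeroth one is the one-dimensional Hilbert space, and the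
`(k+1)`-st one is the completion of the inner product space `E^{⊗k} ⊗ E`. -/
def tensorPowerObj (E : Type u) [NormedAddCommGroup E] [InnerProductSpace ℂ E] :
    ℕ → HilbertSpaceObj.{u}
  | 0 => ⟨EuclideanSpace ℂ PUnit.{u + 1}⟩
  | k + 1 => ⟨UniformSpace.Completion ((tensorPowerObj E k).carrier ⊗[ℂ] E)⟩

/-- The Hilbert space `E^{⊗k}`. -/
abbrev TensorPower (E : Type u) [NormedAddCommGroup E] [InnerProductSpace ℂ E] (k : ℕ) : Type u :=
  (tensorPowerObj E k).carrier

section TensorPower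

variable {E : Type u} [NormedAddCommGroup E] [InnerProductSpace ℂ E]

/-- The vector `x ⊗ y` of `E^{⊗(k+1)}`, for `x` in `E^{⊗k}` and `y` in `E`. -/
def snocTensor {k : ℕ} (x : TensorPower E k) (y : E) : TensorPower E (k + 1) :=
  ((x ⊗ₜ[ℂ] y : TensorPower E k ⊗[ℂ] E) :
    UniformSpace.Completion ((tensorPowerObj E k).carrier ⊗[ℂ] E))

/-- `snocTensor` as a continuous bilinear map. -/
def snocTensorL (k : ℕ) : TensorPower E k →L[ℂ] E →L[ℂ] TensorPower E (k + 1) :=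
  (ContinuousLinearMap.compL ℂ E (TensorPower E k ⊗[ℂ] E)
    (UniformSpace.Completion (TensorPower E k ⊗[ℂ] E)) UniformSpace.Completion.toComplL) ∘L
    (TensorProduct.mkL ℂ (TensorPower E k) E)

theorem snocTensorL_apply {k : ℕ} (x : TensorPower E k) (y : E) :
    snocTensorL k x y = snocTensor x y := rfl

/-- The product vector `x 0 ⊗ x 1 ⊗ ⋯ ⊗ x (k-1)` of `E^{⊗k}`. -/
def productVector : {k : ℕ} → (Fin k → E) → TensorPower E k
  | 0, _ => EuclideanSpace.single PUnit.unit (1 : ℂ)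
  | _ + 1, x => snocTensor (productVector (Fin.init x)) (x (Fin.last _))

/-- The vector `ψ^{⊗k}`. -/
def vectorPower (ψ : E) (k : ℕ) : TensorPower E k := productVector fun _ : Fin k => ψ

/-- The unitary operator on the completion that extends a given unitary operator. -/
def completionUnitary {F : Type u} [NormedAddCommGroup F] [InnerProductSpace ℂ F]
    (V : F ≃ₗᵢ[ℂ] F) : UniformSpace.Completion F ≃ₗᵢ[ℂ] UniformSpace.Completion F where
  toFun := (V.toContinuousLinearEquiv : F →L[ℂ] F).completion
  invFun := (V.symm.toContinuousLinearEquiv : F →L[ℂ] F).completion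
  map_add' := map_add _
  map_smul' := map_smul _
  left_inv x := by
    induction x using UniformSpace.Completion.induction_on with
    | hp => exact isClosed_eq (by fun_prop) continuous_id
    | ih a => simp
  right_inv x := by
    induction x using UniformSpace.Completion.induction_on with
    | hp => exact isClosed_eq (by fun_prop) continuous_id
    | ih a => simp
  norm_map' x := by
    change ‖(V.toContinuousLinearEquiv : F →L[ℂ] F).completion x‖ = ‖x‖
    induction x using UniformSpace.Completion.induction_on with
    | hp => exact isClosed_eq (by fun_prop) continuous_norm
    | ih a => simp

/-- The unitary operator `V^{⊗k}` on `E^{⊗k}`. -/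
def unitaryPower (V : E ≃ₗᵢ[ℂ] E) : (k : ℕ) → TensorPower E k ≃ₗᵢ[ℂ] TensorPower E k
  | 0 => LinearIsometryEquiv.refl ℂ _
  | k + 1 => completionUnitary (TensorProduct.congrIsometry (unitaryPower V k) V)

theorem unitaryPower_snocTensor (V : E ≃ₗᵢ[ℂ] E) {k : ℕ} (x : TensorPower E k) (y : E) :
    unitaryPower V (k + 1) (snocTensor x y) = snocTensor (unitaryPower V k x) (V y) := by
  change (ContinuousLinearMap.completion _ : _ →L[ℂ] _) _ = _
  simp [snocTensor]

theorem unitaryPower_productVector (V : E ≃ₗᵢ[ℂ] E) {k : ℕ} (x : Fin k → E) :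
    unitaryPower V k (productVector x) = productVector fun j => V (x j) := by
  induction k with
  | zero => rfl
  | succ k ih =>
    change unitaryPower V (k + 1) (snocTensor _ _) = _
    rw [unitaryPower_snocTensor, ih]
    rfl

theorem unitaryPower_trans (V W : E ≃ₗᵢ[ℂ] E) (k : ℕ) :
    (unitaryPower V k).trans (unitaryPower W k) = unitaryPower (V.trans W) k := by
  induction k with
  | zero => rfl
  | succ k ih =>
    ext x
    simp only [unitaryPower]
    change (ContinuousLinearMap.completion _ : _ →L[ℂ] _)
      ((ContinuousLinearMap.completion _ : _ →L[ℂ] _) x) =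
      (ContinuousLinearMap.completion _ : _ →L[ℂ] _) x
    induction x using UniformSpace.Completion.induction_on with
    | hp => exact isClosed_eq (by fun_prop) (by fun_prop)
    | ih a =>
      simp only [ContinuousLinearMap.completion_apply_coe]
      congr 1
      induction a with
      | zero => simp
      | tmul a b => simp [← ih]
      | add a b ha hb => rw [map_add, map_add, map_add, ha, hb]

end TensorPower

/-! ### Hamiltonians and time evolution -/

section Dynamics

variable {E : Type u} [NormedAddCommGroup E] [InnerProductSpace ℂ E]

/-- `U t = e^{-i H t}` for all `t`: the family `U` is the strongly continuous one-parameter unitary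
group generated by the possibly unbounded operator `H`. By Stone's theorem each self-adjoint `H` has
exactly one such `U`; the same holds for an essentially self-adjoint `H`, whose `U` is the one of its
closure. -/
structure IsTimeEvolution (H : E →ₗ.[ℂ] E) (U : ℝ → E ≃ₗᵢ[ℂ] E) : Prop where
  add : ∀ s t x, U (s + t) x = U s (U t x)
  continuous : ∀ x, Continuous fun t => U t x
  hasDerivAt : ∀ x : H.domain, HasDerivAt (fun t => U t (x : E)) (-(Complex.I • H x)) 0

/-- The Hamiltonian `∑ⱼ 1 ⊗ ⋯ ⊗ H ⊗ ⋯ ⊗ 1` of `k` systems with Hamiltonian `H`, on the span of the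
product vectors with factors in the domain of `H`; it is given by its graph. For self-adjoint `H` it
is essentially self-adjoint, and `e^{-i t ∑ⱼ 1 ⊗ ⋯ ⊗ H ⊗ ⋯ ⊗ 1} = (e^{-i t H})^{⊗k}`, see
`isTimeEvolution_iidEvolution` below. -/
def iidHamiltonian (H : E →ₗ.[ℂ] E) (k : ℕ) : TensorPower E k →ₗ.[ℂ] TensorPower E k :=
  (Submodule.span ℂ {p : TensorPower E k × TensorPower E k | ∃ x : Fin k → H.domain,
    p = (productVector fun j => (x j : E),
      ∑ j, productVector (Function.update (fun i => (x i : E)) j (H (x j))))}).toLinearPMap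

/-- The time evolution `t ↦ (e^{-i H t})^{⊗k}` of `k` systems with Hamiltonian `H`, given
`U t = e^{-i H t}`. -/
def iidEvolution (U : ℝ → E ≃ₗᵢ[ℂ] E) (k : ℕ) (t : ℝ) : TensorPower E k ≃ₗᵢ[ℂ] TensorPower E k :=
  unitaryPower (U t) k

/-- On product vectors, the generator of `iidEvolution U k` is `∑ⱼ 1 ⊗ ⋯ ⊗ H ⊗ ⋯ ⊗ 1`. -/
theorem hasDerivAt_iidEvolution {H : E →ₗ.[ℂ] E} {U : ℝ → E ≃ₗᵢ[ℂ] E} (hU : IsTimeEvolution H U)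
    {k : ℕ} (x : Fin k → H.domain) :
    HasDerivAt (fun t => iidEvolution U k t (productVector fun j => (x j : E)))
      (-(Complex.I • ∑ j, productVector (Function.update (fun i => (x i : E)) j (H (x j))))) 0 := by
  have h0 : ∀ y, U 0 y = y := fun y => (U 0).injective (by rw [← hU.add, add_zero])
  induction k with
  | zero =>
    simp only [Finset.univ_eq_empty, Finset.sum_empty, smul_zero, neg_zero]
    exact hasDerivAt_const _ _
  | succ k ih =>
    have h1 := ih (Fin.init x)
    have h2 := hU.hasDerivAt (x (Fin.last k))
    have h3 := ((snocTensorL k (E := E)).bilinearRestrictScalars ℝ).hasDerivAt_of_bilinear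
      (fun _ => h1) (fun _ => h2)
    have e : ∀ t, iidEvolution U (k + 1) t (productVector fun j => (x j : E)) =
        snocTensor (iidEvolution U k t (productVector fun j => (Fin.init x j : E)))
          (U t (x (Fin.last k))) := by
      intro t
      simp only [iidEvolution, unitaryPower_productVector]
      rfl
    have hz : iidEvolution U k 0 (productVector fun j => (Fin.init x j : E)) =
        productVector fun j => (Fin.init x j : E) := by
      simp only [iidEvolution, unitaryPower_productVector, h0]
    simp only [e]
    convert! h3 using 1
    rw [hz, h0]
    change _ = snocTensorL k _ _ + snocTensorL k _ _
    have u1 : ∀ j : Fin k, productVector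
        (Function.update (fun i => (x i : E)) j.castSucc (H (x j.castSucc))) =
        snocTensorL k (productVector (Function.update (fun i => (Fin.init x i : E)) j
          (H (Fin.init x j)))) (x (Fin.last k) : E) := by
      intro j
      change snocTensor (productVector (Fin.init (Function.update (fun i => (x i : E)) _ _))) _ = _
      rw [Fin.init_update_castSucc, Function.update_of_ne (Fin.castSucc_lt_last j).ne']
      rfl
    have u2 : productVector
        (Function.update (fun i => (x i : E)) (Fin.last k) (H (x (Fin.last k)))) =
        snocTensorL k (productVector fun i => (Fin.init x i : E)) (H (x (Fin.last k))) := by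
      change snocTensor (productVector (Fin.init (Function.update (fun i => (x i : E)) _ _))) _ = _
      rw [Fin.init_update_last, Function.update_self]
      rfl
    rw [Fin.sum_univ_castSucc, u2, Finset.sum_congr rfl fun j _ => u1 j]
    simp only [map_neg, map_smul, map_sum, neg_apply, smul_apply, sum_apply, smul_add, neg_add]
    abel

/-- `iidEvolution U k` is the time evolution generated by `iidHamiltonian H k`. -/
theorem isTimeEvolution_iidEvolution {H : E →ₗ.[ℂ] E} {U : ℝ → E ≃ₗᵢ[ℂ] E}
    (hU : IsTimeEvolution H U) (k : ℕ) :
    IsTimeEvolution (iidHamiltonian H k) (iidEvolution U k) where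
  add s t x := by
    have : U (s + t) = (U t).trans (U s) := by ext y; exact hU.add s t y
    rw [iidEvolution, this, ← unitaryPower_trans]
    rfl
  continuous x := by
    induction k with
    | zero => exact continuous_const
    | succ k ih =>
      have key : ∀ z : TensorPower E k ⊗[ℂ] E, Continuous fun t =>
          iidEvolution U (k + 1) t (z : UniformSpace.Completion (TensorPower E k ⊗[ℂ] E)) := by
        intro z
        induction z with
        | zero =>
          have : ∀ t, iidEvolution U (k + 1) t
              ((0 : TensorPower E k ⊗[ℂ] E) :
                UniformSpace.Completion (TensorPower E k ⊗[ℂ] E)) = 0 := by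
            intro t
            rw [UniformSpace.Completion.coe_zero]
            exact map_zero _
          simpa only [this] using continuous_const
        | tmul a b =>
          have h : Continuous fun t => snocTensorL k (iidEvolution U k t a) (U t b) :=
            ((snocTensorL k).continuous.comp (ih a)).clm_apply (hU.continuous b)
          refine h.congr fun t => ?_
          exact (unitaryPower_snocTensor (U t) a b).symm
        | add a b ha hb =>
          refine (ha.add hb).congr fun t => ?_
          rw [UniformSpace.Completion.coe_add]
          exact (map_add (iidEvolution U (k + 1) t) _ _).symm
      refine continuous_of_uniform_approx_of_continuous fun u hu => ?_
      obtain ⟨ε, hε, hu⟩ := Metric.mem_uniformity_dist.1 hu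
      obtain ⟨z, hz⟩ := UniformSpace.Completion.denseRange_coe.exists_dist_lt x hε
      exact ⟨_, key z, fun t => hu (((iidEvolution U (k + 1) t).dist_map x _).trans_lt hz)⟩
  hasDerivAt x := by
    let G : Submodule ℂ (TensorPower E k × TensorPower E k) :=
      { carrier := {p | HasDerivAt (fun t => iidEvolution U k t p.1) (-(Complex.I • p.2)) 0}
        zero_mem' := by simpa using hasDerivAt_const (0 : ℝ) (0 : TensorPower E k)
        add_mem' := by
          intro p q hp hq
          have := HasDerivAt.add hp hq
          simpa [neg_add, add_comm] using! this
        smul_mem' := by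
          intro c p hp
          have := HasDerivAt.const_smul c hp
          simpa [smul_comm c Complex.I] using! this }
    have hG : Submodule.span ℂ {p : TensorPower E k × TensorPower E k | ∃ x : Fin k → H.domain,
        p = (productVector fun j => (x j : E),
          ∑ j, productVector (Function.update (fun i => (x i : E)) j (H (x j))))} ≤ G := by
      rw [Submodule.span_le]
      rintro _ ⟨x, rfl⟩
      exact hasDerivAt_iidEvolution hU x
    refine hG (Submodule.mem_graph_toLinearPMap ?_ x)
    rintro ⟨p, q⟩ hp hp0
    have h1 : HasDerivAt (fun t => iidEvolution U k t p) (-(Complex.I • q)) 0 := hG hp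
    simp only at hp0
    subst hp0
    simp only [map_zero] at h1
    have h2 := h1.unique (hasDerivAt_const (0 : ℝ) (0 : TensorPower E k))
    simpa using h2

/-- The period of the vector state `ψ`: `inf {t > 0 | |⟨ψ, e^{-i H t} ψ⟩| = 1}`. (The quantifier over
`U` ranges over exactly one evolution.) -/
def period (H : E →ₗ.[ℂ] E) (ψ : E) : ℝ :=
  sInf {t : ℝ | 0 < t ∧ ∀ U, IsTimeEvolution H U → ‖inner ℂ ψ (U t ψ)‖ = 1}

/-- The variance `⟨ψ|H²|ψ⟩ - ⟨ψ|H|ψ⟩²` of `H` in the unit vector `ψ`. It is finite exactly when `ψ`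
is in the domain of `H`; there `⟨ψ|H²|ψ⟩ = ‖Hψ‖²`. -/
def variance (H : E →ₗ.[ℂ] E) (ψ : H.domain) : ℝ :=
  ‖H ψ‖ ^ 2 - (inner ℂ (ψ : E) (H ψ)).re ^ 2

open Classical in
/-- The matrix element `⟨x|H|y⟩` of a self-adjoint operator, as soon as one of the two vectors is in
the domain (if both are, then the two formulas agree). -/
def matrixElement (H : E →ₗ.[ℂ] E) (x y : E) : ℂ :=
  if hy : y ∈ H.domain then inner ℂ x (H ⟨y, hy⟩)
  else if hx : x ∈ H.domain then inner ℂ (H ⟨x, hx⟩) y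
  else 0

/-- The SLD quantum Fisher information of the state `ρ` computed from an orthonormal eigenbasis
`ρ = ∑ i, l i |b i⟩⟨b i|`; the terms with `l i = l j = 0` vanish. -/
def fisherSum (H : E →ₗ.[ℂ] E) {ι : Type*} (b : HilbertBasis ι ℂ E) (l : ι → ℝ) : ℝ :=
  2 * ∑' p : ι × ι, (l p.1 - l p.2) ^ 2 / (l p.1 + l p.2) * ‖matrixElement H (b p.1) (b p.2)‖ ^ 2

open Classical in
/-- The SLD quantum Fisher information of `ρ` for the family `e^{-i H t} ρ e^{i H t}`:
`2 ∑_{i,j} (λᵢ - λⱼ)² / (λᵢ + λⱼ) |⟨i|H|j⟩|²` for an eigenvalue decomposition of `ρ`. -/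
def fisherInformation (ρ : E →L[ℂ] E) (H : E →ₗ.[ℂ] E) : ℝ :=
  if h : ∃ (w : Set E) (b : HilbertBasis w ℂ E) (l : w → ℝ), ∀ i, ρ (b i) = (l i : ℂ) • b i then
    fisherSum H h.choose_spec.choose h.choose_spec.choose_spec.choose
  else 0

end Dynamics

/-! ### States, channels and conversion -/

section States

variable {E : Type u} [NormedAddCommGroup E] [InnerProductSpace ℂ E]
variable {F : Type v} [NormedAddCommGroup F] [InnerProductSpace ℂ F]

/-- The sums `∑ᵢ |⟨fᵢ, T eᵢ⟩|` over finite orthonormal families `e` and `f`. Their supremum is the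
trace norm of `T`. -/
def traceSums (T : E →L[ℂ] E) : Set ℝ :=
  {s | ∃ (n : ℕ) (e f : Fin n → E), Orthonormal ℂ e ∧ Orthonormal ℂ f ∧
    s = ∑ i, ‖inner ℂ (f i) (T (e i))‖}

variable (E) in
/-- The trace class operators on `E`: those of finite trace norm. -/
def TraceClass : Submodule ℂ (E →L[ℂ] E) where
  carrier := {T | BddAbove (traceSums T)}
  zero_mem' := ⟨0, by rintro _ ⟨n, e, f, -, -, rfl⟩; simp⟩
  add_mem' := by
    rintro S T ⟨A, hA⟩ ⟨B, hB⟩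
    refine ⟨A + B, ?_⟩
    rintro _ ⟨n, e, f, he, hf, rfl⟩
    refine le_trans ?_ (add_le_add (hA ⟨n, e, f, he, hf, rfl⟩) (hB ⟨n, e, f, he, hf, rfl⟩))
    rw [← Finset.sum_add_distrib]
    refine Finset.sum_le_sum fun i _ => ?_
    simpa [inner_add_right] using norm_add_le (inner ℂ (f i) (S (e i))) (inner ℂ (f i) (T (e i)))
  smul_mem' := by
    rintro c T ⟨A, hA⟩
    refine ⟨‖c‖ * A, ?_⟩
    rintro _ ⟨n, e, f, he, hf, rfl⟩
    refine le_trans (le_of_eq ?_)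
      (mul_le_mul_of_nonneg_left (hA ⟨n, e, f, he, hf, rfl⟩) (norm_nonneg c))
    simp [Finset.mul_sum]

/-- The trace norm `‖T‖₁`. -/
def traceNorm (T : TraceClass E) : ℝ := sSup (traceSums (T : E →L[ℂ] E))

/-- The trace distance `‖S - T‖₁ / 2`. -/
def traceDist (S T : TraceClass E) : ℝ := traceNorm (S - T) / 2

/-- The trace of a trace class operator, in some orthonormal basis (it does not depend on it). -/
def trace [CompleteSpace E] (T : TraceClass E) : ℂ :=
  ∑' i, inner ℂ ((exists_hilbertBasis ℂ E).choose_spec.choose i)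
    ((T : E →L[ℂ] E) ((exists_hilbertBasis ℂ E).choose_spec.choose i))

/-- Density operators: positive operators of trace one. -/
def IsState [CompleteSpace E] (ρ : TraceClass E) : Prop :=
  (ρ : E →L[ℂ] E).IsPositive ∧ trace ρ = 1

/-- The operator `V T V†`, for a unitary `V`. -/
def conjugate (V : E ≃ₗᵢ[ℂ] E) (T : TraceClass E) : TraceClass E :=
  ⟨(V.toContinuousLinearEquiv : E →L[ℂ] E) ∘L (T : E →L[ℂ] E) ∘L
    (V.symm.toContinuousLinearEquiv : E →L[ℂ] E), by
    obtain ⟨A, hA⟩ := T.2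
    refine ⟨A, ?_⟩
    rintro _ ⟨n, e, f, he, hf, rfl⟩
    refine le_trans (le_of_eq ?_) (hA ⟨n, V.symm ∘ e, V.symm ∘ f,
      he.comp_linearIsometryEquiv V.symm, hf.comp_linearIsometryEquiv V.symm, rfl⟩)
    refine Finset.sum_congr rfl fun i _ => ?_
    simp [LinearIsometryEquiv.inner_map_eq_flip]⟩

/-- The pure state `|ψ⟩⟨ψ|`. -/
def pureState (ψ : E) : TraceClass E :=
  ⟨InnerProductSpace.rankOne ℂ ψ ψ, by
    refine ⟨‖ψ‖ ^ 2, ?_⟩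
    rintro _ ⟨n, e, f, he, hf, rfl⟩
    have h : ∀ i, ‖inner ℂ (f i) (InnerProductSpace.rankOne ℂ ψ ψ (e i))‖ ≤
        (‖inner ℂ (e i) ψ‖ ^ 2 + ‖inner ℂ (f i) ψ‖ ^ 2) / 2 := by
      intro i
      rw [InnerProductSpace.inner_right_rankOne_apply, norm_mul, norm_inner_symm ψ (e i)]
      nlinarith [sq_nonneg (‖inner ℂ (f i) ψ‖ - ‖inner ℂ (e i) ψ‖)]
    refine (Finset.sum_le_sum fun i _ => h i).trans ?_
    rw [← Finset.sum_div, Finset.sum_add_distrib]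
    have h1 := he.sum_inner_products_le ψ (s := Finset.univ)
    have h2 := hf.sum_inner_products_le ψ (s := Finset.univ)
    linarith⟩

/-- A block operator matrix `[T i j]` is positive. -/
def IsPositiveBlock {n : ℕ} (T : Fin n → Fin n → TraceClass E) : Prop :=
  ∀ x : Fin n → E, ∃ r : ℝ, 0 ≤ r ∧
    ∑ i, ∑ j, inner ℂ (x i) ((T i j : E →L[ℂ] E) (x j)) = (r : ℂ)

/-- Quantum channels: completely positive trace preserving linear maps between the trace class
operators. -/
structure IsChannel [CompleteSpace E] [CompleteSpace F] (Φ : TraceClass E →ₗ[ℂ] TraceClass F) :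
    Prop where
  completelyPositive : ∀ (n : ℕ) (T : Fin n → Fin n → TraceClass E),
    IsPositiveBlock T → IsPositiveBlock fun i j => Φ (T i j)
  tracePreserving : ∀ T, trace (Φ T) = trace T

/-- Covariance of a channel with respect to the time evolutions `U t = e^{-i H t}` and
`U' t = e^{-i H' t}` of the input and output systems:
`Φ(e^{-i H t} ρ e^{i H t}) = e^{-i H' t} Φ(ρ) e^{i H' t}` for all states `ρ` and all `t`. (The
quantifiers over `U` and `U'` range over exactly one evolution each.) -/
def IsCovariant [CompleteSpace E] (H : E →ₗ.[ℂ] E) (H' : F →ₗ.[ℂ] F)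
    (Φ : TraceClass E →ₗ[ℂ] TraceClass F) : Prop :=
  ∀ U U', IsTimeEvolution H U → IsTimeEvolution H' U' →
    ∀ ρ : TraceClass E, IsState ρ → ∀ t : ℝ, Φ (conjugate (U t) ρ) = conjugate (U' t) (Φ ρ)

end States

/-- Asymptotic convertibility by covariant operations: the sequence `ρ` of states of the systems
`X m` with Hamiltonians `H m` is asymptotically convertible to the sequence `σ` of states of the
systems `Y m` with Hamiltonians `H' m`. -/
def AsymptoticallyConvertible {X : ℕ → Type u} {Y : ℕ → Type v}
    [∀ m, NormedAddCommGroup (X m)] [∀ m, InnerProductSpace ℂ (X m)] [∀ m, CompleteSpace (X m)]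
    [∀ m, NormedAddCommGroup (Y m)] [∀ m, InnerProductSpace ℂ (Y m)] [∀ m, CompleteSpace (Y m)]
    (ρ : ∀ m, TraceClass (X m)) (H : ∀ m, X m →ₗ.[ℂ] X m)
    (σ : ∀ m, TraceClass (Y m)) (H' : ∀ m, Y m →ₗ.[ℂ] Y m) : Prop :=
  ∀ ε : ℝ, 0 < ε → ε ≤ 1 →
    ∃ Φ : ∀ m, TraceClass (X m) →ₗ[ℂ] TraceClass (Y m),
      (∀ m, IsChannel (Φ m) ∧ IsCovariant (H m) (H' m) (Φ m)) ∧
      Filter.limsup (fun m => traceDist (Φ m (ρ m)) (σ m)) Filter.atTop ≤ ε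

end Asymmetry

end

open Asymmetry

/-! A covariant channel cannot make a state easier to tell apart from its time translates. For unit
vectors the trace distance of $a$ and $e^{-iHt}a$ is $\sqrt{1-g(t)}$, with $g(t)=|\langle
a|e^{-iHt}a\rangle|^2$ the survival probability, and for a vector of the domain
$g(t)=1-\mathrm{Var}\,t^2+o(t^2)$ (`tendsto_survival_div_sq`). Survival probabilities of product
states are powers, so at the time $t=m^{-1/2}$ the input with $m$ copies has survival probability
tending to $e^{-\mathrm{Var}(\psi)}$, while that of $\lceil Rm\rceil$ output copies is governed by
$e^{-R\,\mathrm{Var}(\phi)}$. A conversion error of order $\epsilon$ therefore yields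
$\sqrt{1-e^{-R\,\mathrm{Var}(\phi)}}\le 4\epsilon+\sqrt{1-e^{-\mathrm{Var}(\psi)}}$
(`AsymptoticallyConvertible.sqrt_one_sub_exp_le`), and $\epsilon\to0$ gives the bound on $R$.

The periods enter through being nonzero. This provides the time evolutions, and it makes the
variance of $\phi$ positive, since a vector of variance zero is an eigenvector, hence stationary,
hence of period zero. The Fisher information of a pure state is $4\,\mathrm{Var}$, so the two ratios
agree. -/

namespace Asymmetry

open Filter Topology

universe u v

/-! ### Trace norm, trace and positivity -/

section TraceNorm

variable {E : Type u} [NormedAddCommGroup E] [InnerProductSpace ℂ E]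

theorem traceSums_nonempty (T : E →L[ℂ] E) : (traceSums T).Nonempty :=
  ⟨_, 0, Fin.elim0, Fin.elim0, ⟨fun i => i.elim0, fun i => i.elim0⟩,
    ⟨fun i => i.elim0, fun i => i.elim0⟩, rfl⟩

theorem le_traceNorm (T : TraceClass E) {n : ℕ} {e f : Fin n → E} (he : Orthonormal ℂ e)
    (hf : Orthonormal ℂ f) : ∑ i, ‖inner ℂ (f i) ((T : E →L[ℂ] E) (e i))‖ ≤ traceNorm T :=
  le_csSup T.2 ⟨n, e, f, he, hf, rfl⟩

theorem traceNorm_le {T : TraceClass E} {c : ℝ}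
    (h : ∀ (n : ℕ) (e f : Fin n → E), Orthonormal ℂ e → Orthonormal ℂ f →
      ∑ i, ‖inner ℂ (f i) ((T : E →L[ℂ] E) (e i))‖ ≤ c) : traceNorm T ≤ c := by
  refine csSup_le (traceSums_nonempty _) ?_
  rintro _ ⟨n, e, f, he, hf, rfl⟩
  exact h n e f he hf

theorem traceNorm_add_le (S T : TraceClass E) :
    traceNorm (S + T) ≤ traceNorm S + traceNorm T := by
  refine traceNorm_le fun n e f he hf => ?_
  refine le_trans ?_ (add_le_add (le_traceNorm S he hf) (le_traceNorm T he hf))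
  rw [← Finset.sum_add_distrib]
  refine Finset.sum_le_sum fun i _ => ?_
  simpa [inner_add_right] using
    norm_add_le (inner ℂ (f i) ((S : E →L[ℂ] E) (e i))) (inner ℂ (f i) ((T : E →L[ℂ] E) (e i)))

theorem traceNorm_neg (T : TraceClass E) : traceNorm (-T) = traceNorm T := by
  simp [traceNorm, traceSums]

theorem traceNorm_sub_le (S T : TraceClass E) :
    traceNorm (S - T) ≤ traceNorm S + traceNorm T := by
  rw [sub_eq_add_neg, ← traceNorm_neg T]
  exact traceNorm_add_le _ _

theorem traceDist_comm (S T : TraceClass E) : traceDist S T = traceDist T S := by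
  rw [traceDist, traceDist, ← neg_sub, traceNorm_neg]

theorem traceDist_triangle (S T U : TraceClass E) :
    traceDist S U ≤ traceDist S T + traceDist T U := by
  have h := traceNorm_add_le (S - T) (T - U)
  rw [sub_add_sub_cancel] at h
  simp only [traceDist]
  linarith

theorem conjugate_sub (V : E ≃ₗᵢ[ℂ] E) (S T : TraceClass E) :
    conjugate V (S - T) = conjugate V S - conjugate V T := by
  apply Subtype.ext
  ext x
  simp [conjugate]

theorem traceNorm_conjugate_le (V : E ≃ₗᵢ[ℂ] E) (T : TraceClass E) :
    traceNorm (conjugate V T) ≤ traceNorm T := by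
  refine traceNorm_le fun n e f he hf => ?_
  refine le_trans (le_of_eq ?_) (le_traceNorm T (he.comp_linearIsometryEquiv V.symm)
    (hf.comp_linearIsometryEquiv V.symm))
  refine Finset.sum_congr rfl fun i _ => ?_
  simp [conjugate, LinearIsometryEquiv.inner_map_eq_flip]

theorem traceDist_conjugate_le (V : E ≃ₗᵢ[ℂ] E) (S T : TraceClass E) :
    traceDist (conjugate V S) (conjugate V T) ≤ traceDist S T := by
  rw [traceDist, traceDist, ← conjugate_sub]
  exact div_le_div_of_nonneg_right (traceNorm_conjugate_le V _) zero_le_two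

theorem conjugate_pureState (V : E ≃ₗᵢ[ℂ] E) (x : E) :
    conjugate V (pureState x) = pureState (V x) := by
  apply Subtype.ext
  ext y
  simp [conjugate, pureState, LinearIsometryEquiv.inner_map_eq_flip]

theorem coe_pureState_apply (x y : E) :
    (pureState x : E →L[ℂ] E) y = (inner ℂ x y : ℂ) • x := by
  simp [pureState]

theorem pureState_smul {z : ℂ} (hz : ‖z‖ = 1) (x : E) : pureState (z • x) = pureState x := by
  apply Subtype.ext
  ext y
  rw [coe_pureState_apply, coe_pureState_apply, inner_smul_left, smul_smul, mul_right_comm,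
    ← Complex.normSq_eq_conj_mul_self, Complex.normSq_eq_norm_sq, hz]
  simp

theorem isPositive_pureState (x : E) : (pureState x : E →L[ℂ] E).IsPositive := by
  simp [pureState]

theorem IsPositive.summable_inner {A : TraceClass E} (hA : (A : E →L[ℂ] E).IsPositive)
    {ι : Type*} (b : HilbertBasis ι ℂ E) :
    Summable fun i => (inner ℂ (b i) ((A : E →L[ℂ] E) (b i))).re := by
  obtain ⟨C, hC⟩ := A.2
  have h0 : ∀ i, 0 ≤ (inner ℂ (b i) ((A : E →L[ℂ] E) (b i))).re :=
    fun i => hA.re_inner_nonneg_right (b i)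
  refine summable_of_sum_le h0 (c := C) fun s => ?_
  have ho : Orthonormal ℂ fun k : Fin s.card => b (s.equivFin.symm k) :=
    b.orthonormal.comp (fun k : Fin s.card => (s.equivFin.symm k : ι))
      (Subtype.val_injective.comp s.equivFin.symm.injective)
  refine le_trans ?_ (hC ⟨_, _, _, ho, ho, rfl⟩)
  rw [← Finset.sum_coe_sort s, ← s.equivFin.symm.sum_comp]
  exact Finset.sum_le_sum fun i _ => Complex.re_le_norm _

theorem hasSum_norm_inner_sq {ι : Type*} (b : HilbertBasis ι ℂ E) (x : E) :
    HasSum (fun i => ‖(inner ℂ (b i) x : ℂ)‖ ^ 2) (‖x‖ ^ 2) := by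
  have h := Complex.hasSum_re (b.hasSum_inner_mul_inner x x)
  rw [inner_self_eq_norm_sq_to_K] at h
  convert! h using 1
  · ext i
    rw [← inner_conj_symm x, ← Complex.normSq_eq_conj_mul_self, Complex.ofReal_re,
      Complex.normSq_eq_norm_sq]
  · norm_cast

variable [CompleteSpace E]

/-- With $B=\sqrt A$, matrix elements of $A$ become inner products, open to Bessel and
Cauchy–Schwarz. -/
theorem IsPositive.exists_sqrt {A : E →L[ℂ] E} (hA : A.IsPositive) :
    ∃ B : E →L[ℂ] E, (∀ x y, inner ℂ (B x) y = inner ℂ x (B y)) ∧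
      ∀ x y, inner ℂ x (A y) = inner ℂ (B x) (B y) := by
  have h0 : 0 ≤ A := (ContinuousLinearMap.nonneg_iff_isPositive A).2 hA
  have hs : (CFC.sqrt A).IsPositive :=
    (ContinuousLinearMap.nonneg_iff_isPositive _).1 (CFC.sqrt_nonneg A)
  refine ⟨CFC.sqrt A, hs.inner_left_eq_inner_right, fun x y => ?_⟩
  rw [hs.inner_left_eq_inner_right, ← mul_apply_eq_comp, CFC.sqrt_mul_sqrt_self A h0]

theorem trace_re_of_isPositive {A : TraceClass E} (hA : (A : E →L[ℂ] E).IsPositive) :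
    (trace A).re = ∑' i, (inner ℂ ((exists_hilbertBasis ℂ E).choose_spec.choose i)
      ((A : E →L[ℂ] E) ((exists_hilbertBasis ℂ E).choose_spec.choose i))).re := by
  rw [trace, Complex.re_tsum]
  have h := IsPositive.summable_inner hA (exists_hilbertBasis ℂ E).choose_spec.choose
  refine (Complex.hasSum_ofReal.2 h.hasSum).summable.congr fun i => ?_
  have := hA.inner_nonneg_right ((exists_hilbertBasis ℂ E).choose_spec.choose i)
  exact (Complex.eq_re_of_ofReal_le (r := 0) (by simpa using this)).symm

/-- `trace` is computed in one chosen basis $b$, so an arbitrary orthonormal family has to be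
compared with it: expand each $\|Be_i\|^2$ in $b$, exchange the sums, and apply Bessel to the
vectors $Bb_j$. -/
theorem IsPositive.sum_inner_le_trace {A : TraceClass E} (hA : (A : E →L[ℂ] E).IsPositive)
    {n : ℕ} {e : Fin n → E} (he : Orthonormal ℂ e) :
    ∑ i, (inner ℂ (e i) ((A : E →L[ℂ] E) (e i))).re ≤ (trace A).re := by
  obtain ⟨B, hBs, hB⟩ := IsPositive.exists_sqrt hA
  rw [trace_re_of_isPositive hA]
  have hs := IsPositive.summable_inner hA (exists_hilbertBasis ℂ E).choose_spec.choose
  generalize (exists_hilbertBasis ℂ E).choose_spec.choose = b at hs ⊢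
  have hp : ∀ x, (inner ℂ x ((A : E →L[ℂ] E) x)).re = ‖B x‖ ^ 2 := fun x => by
    rw [hB, inner_self_eq_norm_sq_to_K]
    norm_cast
  simp only [hp] at hs ⊢
  have hsum : HasSum (fun j => ∑ i, ‖(inner ℂ (e i) (B (b j)) : ℂ)‖ ^ 2) (∑ i, ‖B (e i)‖ ^ 2) := by
    refine hasSum_sum fun i _ => ?_
    refine (hasSum_norm_inner_sq b (B (e i))).congr_fun fun j => ?_
    rw [← hBs, norm_inner_symm]
  exact hasSum_le (fun j => he.sum_inner_products_le (B (b j))) hsum hs.hasSum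

theorem IsPositive.traceNorm_le_trace {A : TraceClass E} (hA : (A : E →L[ℂ] E).IsPositive) :
    traceNorm A ≤ (trace A).re := by
  obtain ⟨B, hBs, hB⟩ := IsPositive.exists_sqrt hA
  have hp : ∀ x, (inner ℂ x ((A : E →L[ℂ] E) x)).re = ‖B x‖ ^ 2 := fun x => by
    rw [hB, inner_self_eq_norm_sq_to_K]
    norm_cast
  refine traceNorm_le fun n e f he hf => ?_
  have h1 := IsPositive.sum_inner_le_trace hA he
  have h2 := IsPositive.sum_inner_le_trace hA hf
  simp only [hp] at h1 h2
  calc ∑ i, ‖inner ℂ (f i) ((A : E →L[ℂ] E) (e i))‖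
      ≤ ∑ i, (‖B (e i)‖ ^ 2 + ‖B (f i)‖ ^ 2) / 2 := by
        refine Finset.sum_le_sum fun i _ => ?_
        rw [hB]
        have := norm_inner_le_norm (𝕜 := ℂ) (B (f i)) (B (e i))
        nlinarith [sq_nonneg (‖B (f i)‖ - ‖B (e i)‖)]
    _ ≤ (trace A).re := by
        rw [← Finset.sum_div, Finset.sum_add_distrib]
        linarith

theorem trace_pureState (x : E) : trace (pureState x) = (‖x‖ ^ 2 : ℝ) := by
  rw [trace]
  generalize (exists_hilbertBasis ℂ E).choose_spec.choose = b
  refine HasSum.tsum_eq ?_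
  refine (Complex.hasSum_ofReal.2 (hasSum_norm_inner_sq b x)).congr_fun fun i => ?_
  rw [coe_pureState_apply, inner_smul_right, ← inner_conj_symm x,
    ← Complex.normSq_eq_conj_mul_self, Complex.normSq_eq_norm_sq]

theorem traceNorm_pureState_le (x : E) : traceNorm (pureState x) ≤ ‖x‖ ^ 2 := by
  refine (IsPositive.traceNorm_le_trace (isPositive_pureState x)).trans_eq ?_
  rw [trace_pureState, Complex.ofReal_re]

theorem isState_pureState {x : E} (hx : ‖x‖ = 1) : IsState (pureState x) :=
  ⟨isPositive_pureState x, by rw [trace_pureState, hx]; simp⟩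

end TraceNorm

/-! ### Trace distance of pure states -/

section PureStates

variable {E : Type u} [NormedAddCommGroup E] [InnerProductSpace ℂ E]

theorem exists_phase_smul_inner_eq_norm (a b : E) :
    ∃ z : ℂ, ‖z‖ = 1 ∧ inner ℂ a (z • b) = (‖(inner ℂ a b : ℂ)‖ : ℂ) := by
  by_cases h : (inner ℂ a b : ℂ) = 0
  · exact ⟨1, by simp, by simp [h]⟩
  · have hn : (‖(inner ℂ a b : ℂ)‖ : ℂ) ≠ 0 := by simpa using h
    refine ⟨‖(inner ℂ a b : ℂ)‖ / inner ℂ a b, by simp [h], ?_⟩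
    rw [inner_smul_right, div_mul_cancel₀ _ h]

/-- The difference of two pure states is the difference of its positive and negative parts, which
have orthogonal ranges. -/
theorem exists_pureState_sub_eq {a b : E} (ha : ‖a‖ = 1) (hb : ‖b‖ = 1) :
    ∃ p q : E, inner ℂ p q = (0 : ℂ) ∧ ‖p‖ ^ 2 = √(1 - ‖(inner ℂ a b : ℂ)‖ ^ 2) ∧
      ‖q‖ ^ 2 = √(1 - ‖(inner ℂ a b : ℂ)‖ ^ 2) ∧
      pureState a - pureState b = pureState p - pureState q := by
  obtain ⟨z, hz, hab⟩ := exists_phase_smul_inner_eq_norm a b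
  have hd : ‖z • b‖ = 1 := by rw [norm_smul, hz, hb, one_mul]
  have hc1 : ‖(inner ℂ a b : ℂ)‖ ≤ 1 := by
    simpa [ha, hb] using norm_inner_le_norm (𝕜 := ℂ) a b
  have hc0 : 0 ≤ ‖(inner ℂ a b : ℂ)‖ := norm_nonneg _
  -- A phase does not change the projection, so the overlap may be taken real and nonnegative.
  rw [← pureState_smul hz b]
  generalize z • b = d at hab hd ⊢
  generalize ‖(inner ℂ a b : ℂ)‖ = c at hab hc0 hc1 ⊢
  rcases hc1.eq_or_lt with rfl | hc
  · have : a = d := (inner_eq_one_iff_of_norm_eq_one (𝕜 := ℂ) ha hd).1 (by simpa using hab)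
    subst this
    exact ⟨0, 0, by simp, by simp, by simp, by simp⟩
  have hda : inner ℂ d a = (c : ℂ) := by rw [← inner_conj_symm, hab, Complex.conj_ofReal]
  have hs2 : 0 < 1 - c ^ 2 := by nlinarith
  set s := √(1 - c ^ 2) with hs
  have hs0 : 0 < s := Real.sqrt_pos.2 hs2
  have hss : s ^ 2 = 1 - c ^ 2 := Real.sq_sqrt hs2.le
  have hs1 : s ≤ 1 := by nlinarith
  have hi : 1 ≤ 1 / s := (one_le_div hs0).2 hs1
  -- Ansatz $p=\alpha a+\beta d$, $q=\beta a+\alpha d$: the cross terms of the projections cancel,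
  -- equality of the differences means $\alpha^2-\beta^2=1$, and orthogonality means
  -- $2\alpha\beta+(\alpha^2+\beta^2)c=0$. Solving gives $\alpha^2+\beta^2=1/s$ with $\alpha\beta<0$
  -- unless $c=0$.
  obtain ⟨α, β, h1, h2, h3⟩ : ∃ α β : ℝ, α ^ 2 = (1 / s + 1) / 2 ∧ β ^ 2 = (1 / s - 1) / 2 ∧
      α * β = -(c / (2 * s)) := by
    refine ⟨√((1 / s + 1) / 2), -√((1 / s - 1) / 2), Real.sq_sqrt (by linarith), ?_, ?_⟩
    · rw [neg_sq, Real.sq_sqrt (by linarith)]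
    · have : (1 / s + 1) / 2 * ((1 / s - 1) / 2) = (c / (2 * s)) ^ 2 := by
        field_simp
        linarith
      rw [mul_neg, ← Real.sqrt_mul (by linarith), this, Real.sqrt_sq (by positivity)]
  have hnorm : ∀ x y : ℝ, ‖(x : ℂ) • a + (y : ℂ) • d‖ ^ 2 = x ^ 2 + y ^ 2 + 2 * (x * y) * c := by
    intro x y
    rw [@norm_add_sq ℂ, norm_smul, norm_smul, inner_smul_left, inner_smul_right, hab, ha, hd]
    simp
    ring
  refine ⟨(α : ℂ) • a + (β : ℂ) • d, (β : ℂ) • a + (α : ℂ) • d, ?_, ?_, ?_, ?_⟩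
  · simp only [inner_add_left, inner_add_right, inner_smul_left, inner_smul_right, hab, hda,
      inner_self_eq_norm_sq_to_K, ha, hd, Complex.conj_ofReal]
    have h4 : α ^ 2 + β ^ 2 = 1 / s := by rw [h1, h2]; ring
    have h5 : 2 * (α * β) + (α ^ 2 + β ^ 2) * c = 0 := by
      rw [h3, h4]
      field_simp
      ring
    have h6 : 2 * ((α : ℂ) * β) + ((α : ℂ) ^ 2 + (β : ℂ) ^ 2) * c = 0 := by exact_mod_cast h5
    push_cast
    linear_combination h6
  · rw [hnorm, h1, h2, h3]
    field_simp
    linear_combination -2 * hss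
  · rw [hnorm, h1, h2, mul_comm β, h3]
    field_simp
    linear_combination -2 * hss
  · have h6 : (α : ℂ) ^ 2 - (β : ℂ) ^ 2 = 1 := by
      norm_cast
      rw [h1, h2]
      ring
    apply Subtype.ext
    ext x
    change (pureState a : E →L[ℂ] E) x - (pureState d : E →L[ℂ] E) x =
      (pureState ((α : ℂ) • a + (β : ℂ) • d) : E →L[ℂ] E) x -
        (pureState ((β : ℂ) • a + (α : ℂ) • d) : E →L[ℂ] E) x
    simp only [coe_pureState_apply, inner_add_left, inner_smul_left, Complex.conj_ofReal]
    match_scalars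
    · linear_combination -(inner ℂ a x : ℂ) * h6
    · linear_combination (inner ℂ d x : ℂ) * h6

theorem traceNorm_nonneg (T : TraceClass E) : 0 ≤ traceNorm T :=
  (le_traceNorm T (n := 0) (e := Fin.elim0) (f := Fin.elim0) ⟨fun i => i.elim0, fun i => i.elim0⟩
    ⟨fun i => i.elim0, fun i => i.elim0⟩).trans' (by simp)

/-- Testing the trace norm on the normalized orthogonal pair $p,q$ gives $\|p\|^2+\|q\|^2$, twice
the left side. -/
theorem sqrt_le_traceDist_pureState {a b : E} (ha : ‖a‖ = 1) (hb : ‖b‖ = 1) :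
    √(1 - ‖(inner ℂ a b : ℂ)‖ ^ 2) ≤ traceDist (pureState a) (pureState b) := by
  obtain ⟨p, q, hpq, hp, hq, h⟩ := exists_pureState_sub_eq ha hb
  rw [traceDist, h]
  generalize √(1 - ‖(inner ℂ a b : ℂ)‖ ^ 2) = s at hp hq ⊢
  rcases le_or_gt s 0 with hs | hs
  · exact hs.trans (div_nonneg (traceNorm_nonneg _) zero_le_two)
  have hp0 : ‖p‖ ≠ 0 := fun h0 => by rw [h0] at hp; simp at hp; exact hs.ne hp
  have hq0 : ‖q‖ ≠ 0 := fun h0 => by rw [h0] at hq; simp at hq; exact hs.ne hq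
  have hqp : inner ℂ q p = (0 : ℂ) := inner_eq_zero_symm.1 hpq
  have ho : Orthonormal ℂ ![((‖p‖⁻¹ : ℝ) : ℂ) • p, ((‖q‖⁻¹ : ℝ) : ℂ) • q] := by
    rw [orthonormal_vecCons_iff]
    refine ⟨?_, ?_, ?_⟩
    · rw [norm_smul]
      simp [hp0]
    · intro i
      simp [inner_smul_left, inner_smul_right, hpq]
    · rw [orthonormal_vecCons_iff]
      refine ⟨?_, fun i => i.elim0, ⟨fun i => i.elim0, fun i => i.elim0⟩⟩
      rw [norm_smul]
      simp [hq0]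
  have := le_traceNorm (pureState p - pureState q) ho ho
  have hsub : ∀ x, ((pureState p - pureState q : TraceClass E) : E →L[ℂ] E) x =
      (inner ℂ p x : ℂ) • p - (inner ℂ q x : ℂ) • q := fun x => by
    rw [← coe_pureState_apply, ← coe_pureState_apply]
    rfl
  simp only [hsub, Fin.sum_univ_two, Matrix.cons_val_zero, Matrix.cons_val_one, inner_smul_right,
    inner_smul_left, inner_sub_right, hpq, hqp, inner_self_eq_norm_sq_to_K, norm_neg, norm_mul,
    Complex.conj_ofReal, mul_zero, zero_sub, sub_zero] at this
  simp at this
  field_simp at this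
  linarith

end PureStates

/-! ### Channels and distinguishability -/

section Channels

variable {E : Type u} [NormedAddCommGroup E] [InnerProductSpace ℂ E] [CompleteSpace E]
variable {F : Type v} [NormedAddCommGroup F] [InnerProductSpace ℂ F] [CompleteSpace F]

theorem IsChannel.isPositive {Φ : TraceClass E →ₗ[ℂ] TraceClass F} (hΦ : IsChannel Φ)
    {T : TraceClass E} (hT : (T : E →L[ℂ] E).IsPositive) : (Φ T : F →L[ℂ] F).IsPositive := by
  -- Positivity is complete positivity for one-by-one blocks.
  have h := hΦ.completelyPositive 1 (fun _ _ => T) fun x =>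
    ⟨(inner ℂ (x 0) ((T : E →L[ℂ] E) (x 0))).re, hT.re_inner_nonneg_right (x 0), by
      have := hT.inner_nonneg_right (x 0)
      simpa using Complex.eq_re_of_ofReal_le (r := 0) (by simpa using this)⟩
  rw [ContinuousLinearMap.isPositive_iff_complex]
  intro x
  obtain ⟨r, hr, hx⟩ := h fun _ => x
  simp only [Finset.univ_unique, Finset.sum_singleton] at hx
  rw [← inner_conj_symm, hx]
  simpa using hr

theorem IsChannel.traceNorm_pureState_le {Φ : TraceClass E →ₗ[ℂ] TraceClass F}
    (hΦ : IsChannel Φ) (x : E) : traceNorm (Φ (pureState x)) ≤ ‖x‖ ^ 2 := by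
  refine (IsPositive.traceNorm_le_trace (hΦ.isPositive (isPositive_pureState x))).trans_eq ?_
  rw [hΦ.tracePreserving, trace_pureState, Complex.ofReal_re]

/-- The images of the positive and negative parts stay positive and keep their traces, so each has
trace norm at most the square root on the right. -/
theorem IsChannel.traceDist_pureState_le_sqrt {Φ : TraceClass E →ₗ[ℂ] TraceClass F}
    (hΦ : IsChannel Φ) {a b : E} (ha : ‖a‖ = 1) (hb : ‖b‖ = 1) :
    traceDist (Φ (pureState a)) (Φ (pureState b)) ≤ √(1 - ‖(inner ℂ a b : ℂ)‖ ^ 2) := by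
  obtain ⟨p, q, -, hp, hq, h⟩ := exists_pureState_sub_eq ha hb
  rw [traceDist, ← map_sub, h, map_sub]
  have h1 := hΦ.traceNorm_pureState_le p
  have h2 := hΦ.traceNorm_pureState_le q
  have h3 := traceNorm_sub_le (Φ (pureState p)) (Φ (pureState q))
  linarith

/-- This uniform bound is what makes the real-valued `limsup` of the errors meaningful. -/
theorem IsChannel.traceDist_pureState_le_one {Φ : TraceClass E →ₗ[ℂ] TraceClass F}
    (hΦ : IsChannel Φ) {a : E} {b : F} (ha : ‖a‖ = 1) (hb : ‖b‖ = 1) :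
    traceDist (Φ (pureState a)) (pureState b) ≤ 1 := by
  have h1 := hΦ.traceNorm_pureState_le a
  have h2 := Asymmetry.traceNorm_pureState_le b
  have h3 := traceNorm_sub_le (Φ (pureState a)) (pureState b)
  rw [ha] at h1
  rw [hb] at h2
  rw [traceDist]
  linarith

/-- A covariant channel that maps `a` approximately to `b` can only decrease the distinguishability
of the states from their time translates. -/
theorem IsCovariant.sqrt_le_add_sqrt {H : E →ₗ.[ℂ] E} {H' : F →ₗ.[ℂ] F}
    {Φ : TraceClass E →ₗ[ℂ] TraceClass F} (hΦ : IsChannel Φ) (hcov : IsCovariant H H' Φ)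
    {U : ℝ → E ≃ₗᵢ[ℂ] E} {U' : ℝ → F ≃ₗᵢ[ℂ] F} (hU : IsTimeEvolution H U)
    (hU' : IsTimeEvolution H' U') {a : E} {b : F} (ha : ‖a‖ = 1) (hb : ‖b‖ = 1) (t : ℝ) :
    √(1 - ‖(inner ℂ b (U' t b) : ℂ)‖ ^ 2) ≤
      2 * traceDist (Φ (pureState a)) (pureState b) + √(1 - ‖(inner ℂ a (U t a) : ℂ)‖ ^ 2) := by
  have h1 := sqrt_le_traceDist_pureState hb ((U' t).norm_map b ▸ hb)
  have h2 := hΦ.traceDist_pureState_le_sqrt ha ((U t).norm_map a ▸ ha)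
  have h3 := traceDist_conjugate_le (U' t) (Φ (pureState a)) (pureState b)
  rw [← hcov U U' hU hU' _ (isState_pureState ha), conjugate_pureState, conjugate_pureState] at h3
  -- Chain $b\to\Phi(a)\to\Phi(U_ta)\to U'_tb$: by covariance the last link is the first one
  -- translated in time, so the conversion error is paid twice.
  have h4 := traceDist_triangle (pureState b) (Φ (pureState a)) (pureState (U' t b))
  have h5 := traceDist_triangle (Φ (pureState a)) (Φ (pureState (U t a))) (pureState (U' t b))
  rw [traceDist_comm (pureState b) (Φ _)] at h4
  linarith

end Channels

/-! ### Survival probability, period and variance -/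

section Dynamics

variable {E : Type u} [NormedAddCommGroup E] [InnerProductSpace ℂ E]

theorem inner_vectorPower (x y : E) (k : ℕ) :
    (inner ℂ (vectorPower x k) (vectorPower y k) : ℂ) = inner ℂ x y ^ k := by
  induction k with
  | zero =>
    change inner ℂ (EuclideanSpace.single PUnit.unit (1 : ℂ))
      (EuclideanSpace.single PUnit.unit (1 : ℂ)) = _
    simp
  | succ k ih =>
    change inner ℂ (snocTensor (vectorPower x k) x) (snocTensor (vectorPower y k) y) = _
    refine (UniformSpace.Completion.inner_coe (E := TensorPower E k ⊗[ℂ] E) _ _).trans ?_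
    rw [TensorProduct.inner_tmul, ih, pow_succ]

theorem norm_vectorPower {x : E} (hx : ‖x‖ = 1) (k : ℕ) : ‖vectorPower x k‖ = 1 := by
  have h := inner_vectorPower x x k
  rw [inner_self_eq_norm_sq_to_K, inner_self_eq_norm_sq_to_K, hx] at h
  norm_cast at h
  exact (pow_eq_one_iff_of_nonneg (norm_nonneg _) two_ne_zero).1 (by simpa using h)

theorem iidEvolution_vectorPower (U : ℝ → E ≃ₗᵢ[ℂ] E) (k : ℕ) (t : ℝ) (x : E) :
    iidEvolution U k t (vectorPower x k) = vectorPower (U t x) k :=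
  unitaryPower_productVector _ _

theorem norm_inner_iidEvolution_sq (U : ℝ → E ≃ₗᵢ[ℂ] E) (x : E) (k : ℕ) (t : ℝ) :
    ‖(inner ℂ (vectorPower x k) (iidEvolution U k t (vectorPower x k)) : ℂ)‖ ^ 2 =
      (‖(inner ℂ x (U t x) : ℂ)‖ ^ 2) ^ k := by
  rw [iidEvolution_vectorPower, inner_vectorPower, norm_pow, pow_right_comm]

theorem IsTimeEvolution.apply_zero {H : E →ₗ.[ℂ] E} {U : ℝ → E ≃ₗᵢ[ℂ] E}
    (hU : IsTimeEvolution H U) (x : E) : U 0 x = x :=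
  (U 0).injective (by rw [← hU.add, add_zero])

theorem IsTimeEvolution.hasDerivAt_apply {H : E →ₗ.[ℂ] E} {U : ℝ → E ≃ₗᵢ[ℂ] E}
    (hU : IsTimeEvolution H U) (x : H.domain) (t : ℝ) :
    HasDerivAt (fun s => U s (x : E)) (U t (-(Complex.I • H x))) t := by
  have h0 : HasDerivAt (fun s => U s (x : E)) (-(Complex.I • H x)) (t - t) := by
    rw [sub_self]
    exact hU.hasDerivAt x
  have h2 := (((U t).toContinuousLinearEquiv : E →L[ℂ] E).restrictScalars ℝ).hasFDerivAt
    |>.comp_hasDerivAt t (h0.comp_sub_const t t)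
  refine h2.congr_of_eventuallyEq (Eventually.of_forall fun s => ?_)
  change U s x = U t (U (s - t) x)
  rw [← hU.add, add_sub_cancel]

/-- Eigenvectors are stationary. -/
theorem IsTimeEvolution.apply_eigenvector {H : E →ₗ.[ℂ] E} {U : ℝ → E ≃ₗᵢ[ℂ] E}
    (hU : IsTimeEvolution H U) {x : H.domain} {c : ℂ} (hx : H x = c • (x : E)) (t : ℝ) :
    Complex.exp (Complex.I * c * t) • U t (x : E) = x := by
  have he : ∀ s : ℝ, HasDerivAt (fun s : ℝ => Complex.exp (Complex.I * c * s))
      (Complex.exp (Complex.I * c * s) * (Complex.I * c)) s := fun s => by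
    have h1 : HasDerivAt (fun s : ℝ => Complex.I * c * (s : ℂ)) (Complex.I * c) s := by
      simpa using (Complex.ofRealCLM.hasDerivAt (x := s)).const_mul (Complex.I * c)
    exact h1.cexp
  have hd : ∀ s : ℝ, HasDerivAt (fun s : ℝ => Complex.exp (Complex.I * c * s) • U s (x : E))
      0 s := fun s => by
    convert! (he s).smul (hU.hasDerivAt_apply x s) using 1
    rw [hx, map_neg, map_smul, map_smul]
    module
  have := is_const_of_deriv_eq_zero (fun s => (hd s).differentiableAt) (fun s => (hd s).deriv) t 0
  simpa [hU.apply_zero] using this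

/-- Without an evolution the condition in `period` is vacuous at every positive time and the infimum
is zero. This takes the place of Stone's theorem. -/
theorem exists_isTimeEvolution_of_period_ne_zero {H : E →ₗ.[ℂ] E} {x : E} (h : period H x ≠ 0) :
    ∃ U, IsTimeEvolution H U := by
  by_contra hn
  push Not at hn
  refine h ?_
  have : {t : ℝ | 0 < t ∧ ∀ U, IsTimeEvolution H U → ‖(inner ℂ x (U t x) : ℂ)‖ = 1} =
      Set.Ioi 0 := by
    ext t
    exact ⟨fun h => h.1, fun h => ⟨h, fun U hU => (hn U hU).elim⟩⟩
  rw [period, this, csInf_Ioi]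

theorem period_eigenvector {H : E →ₗ.[ℂ] E} {x : H.domain} (hx1 : ‖(x : E)‖ = 1) {c : ℂ}
    (hx : H x = c • (x : E)) : period H (x : E) = 0 := by
  have : {t : ℝ | 0 < t ∧ ∀ U, IsTimeEvolution H U → ‖(inner ℂ (x : E) (U t x) : ℂ)‖ = 1} =
      Set.Ioi 0 := by
    ext t
    refine ⟨fun h => h.1, fun h => ⟨h, fun U hU => ?_⟩⟩
    have h1 := hU.apply_eigenvector hx t
    -- The eigenvalue is not assumed real; that the factor is a phase follows from `U t` being
    -- isometric.
    have h2 : ‖Complex.exp (Complex.I * c * t)‖ = 1 := by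
      simpa [norm_smul, hx1] using congrArg norm h1
    have h3 : Complex.exp (Complex.I * c * t) * inner ℂ (x : E) (U t x) = 1 := by
      rw [← inner_smul_right, h1, inner_self_eq_norm_sq_to_K, hx1]
      simp
    simpa [h2] using congrArg norm h3
  rw [period, this, csInf_Ioi]

theorem norm_sub_inner_smul_sq {x : E} (hx : ‖x‖ = 1) (y : E) :
    ‖y - (inner ℂ x y : ℂ) • x‖ ^ 2 = ‖y‖ ^ 2 - ‖(inner ℂ x y : ℂ)‖ ^ 2 := by
  rw [@norm_sub_sq ℂ, norm_smul, hx, inner_smul_right, ← inner_conj_symm y x,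
    Complex.mul_conj, Complex.normSq_eq_norm_sq, mul_one, RCLike.re_eq_complex_re,
    Complex.ofReal_re]
  ring

theorem variance_smul {H : E →ₗ.[ℂ] E} {z : ℂ} (hz : ‖z‖ = 1) (x : H.domain) :
    variance H (z • x) = variance H x := by
  have h : (starRingEnd ℂ) z * z = 1 := by
    rw [← Complex.normSq_eq_conj_mul_self, Complex.normSq_eq_norm_sq, hz]
    simp
  rw [variance, variance, H.map_smul, norm_smul, hz, Submodule.coe_smul, inner_smul_left,
    inner_smul_right, ← mul_assoc, h, one_mul, one_mul]

section SelfAdjoint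

variable [CompleteSpace E]

theorem inner_apply_left {H : E →ₗ.[ℂ] E} (hH : IsSelfAdjoint H) (x y : H.domain) :
    inner ℂ (H x) (y : E) = inner ℂ (x : E) (H y) := by
  have h := LinearPMap.adjoint_isFormalAdjoint hH.dense_domain
  rw [LinearPMap.isSelfAdjoint_def.1 hH] at h
  exact h x y

theorem variance_eq_norm_sq_sub {H : E →ₗ.[ℂ] E} (hH : IsSelfAdjoint H) (x : H.domain) :
    variance H x = ‖H x‖ ^ 2 - ‖(inner ℂ (x : E) (H x) : ℂ)‖ ^ 2 := by
  have h : (inner ℂ (x : E) (H x) : ℂ) = (inner ℂ (x : E) (H x) : ℂ).re := by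
    refine (Complex.conj_eq_iff_re.1 ?_).symm
    rw [inner_conj_symm, inner_apply_left hH]
  rw [variance]
  conv_rhs => rw [h]
  rw [Complex.norm_real, Real.norm_eq_abs, sq_abs]

theorem variance_eq_norm_sq {H : E →ₗ.[ℂ] E} (hH : IsSelfAdjoint H) {x : H.domain}
    (hx : ‖(x : E)‖ = 1) :
    variance H x = ‖H x - (inner ℂ (x : E) (H x) : ℂ) • (x : E)‖ ^ 2 := by
  rw [variance_eq_norm_sq_sub hH, norm_sub_inner_smul_sq hx]

theorem variance_pos_of_period_ne_zero {H : E →ₗ.[ℂ] E} (hH : IsSelfAdjoint H) {x : H.domain}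
    (hx : ‖(x : E)‖ = 1) (hp : period H (x : E) ≠ 0) : 0 < variance H x := by
  rw [variance_eq_norm_sq hH hx]
  refine pow_pos (norm_pos_iff.2 fun h => hp ?_) 2
  exact period_eigenvector hx (sub_eq_zero.1 h)

/-- The survival probability decays quadratically, at a rate given by the variance. -/
theorem tendsto_survival_div_sq {H : E →ₗ.[ℂ] E} (hH : IsSelfAdjoint H) {U : ℝ → E ≃ₗᵢ[ℂ] E}
    (hU : IsTimeEvolution H U) {x : H.domain} (hx : ‖(x : E)‖ = 1) :
    Tendsto (fun t => (1 - ‖(inner ℂ (x : E) (U t x) : ℂ)‖ ^ 2) / t ^ 2) (𝓝[≠] 0)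
      (𝓝 (variance H x)) := by
  -- With `L` the projection onto the complement of `x`, $1-|\langle x|U_tx\rangle|^2=\|LU_tx\|^2$
  -- exactly. As $LU_tx$ vanishes at $0$, its first derivative $-iLHx$ suffices, and $x$ need not be
  -- in the domain of $H^2$.
  let L : E →L[ℂ] E := .id ℂ E - InnerProductSpace.rankOne ℂ (x : E) (x : E)
  have hL : ∀ y, L y = y - (inner ℂ (x : E) y : ℂ) • (x : E) := fun y => by
    simp [L]
  have hL0 : L x = 0 := by
    rw [hL, inner_self_eq_norm_sq_to_K, hx]
    simp
  have h1 := (L.restrictScalars ℝ).hasFDerivAt.comp_hasDerivAt (0 : ℝ) (hU.hasDerivAt x)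
  rw [hasDerivAt_iff_tendsto_slope_zero] at h1
  have h2 := (h1.norm).pow 2
  have h3 : variance H x = ‖(L.restrictScalars ℝ) (-(Complex.I • H x))‖ ^ 2 := by
    rw [variance_eq_norm_sq hH hx, ← hL]
    simp [norm_smul]
  rw [h3]
  refine h2.congr fun t => ?_
  simp only [Function.comp_apply, zero_add, hU.apply_zero, ContinuousLinearMap.coe_restrictScalars',
    hL0, sub_zero]
  rw [norm_smul, mul_pow, hL, norm_sub_inner_smul_sq hx, (U t).norm_map, hx, norm_inv,
    Real.norm_eq_abs, inv_pow, sq_abs, one_pow]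
  ring

end SelfAdjoint

end Dynamics

/-! ### Fisher information of pure states -/

section Fisher

variable {E : Type u} [NormedAddCommGroup E] [InnerProductSpace ℂ E] [CompleteSpace E]

/-- Here `y` is arbitrary because the other vectors of an eigenbasis may lie outside the domain. -/
theorem norm_matrixElement {H : E →ₗ.[ℂ] E} (hH : IsSelfAdjoint H) (x : H.domain) (y : E) :
    ‖matrixElement H y x‖ = ‖(inner ℂ y (H x) : ℂ)‖ ∧
      ‖matrixElement H x y‖ = ‖(inner ℂ y (H x) : ℂ)‖ := by
  constructor
  · rw [matrixElement, dif_pos x.2]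
  · rw [matrixElement]
    by_cases hy : y ∈ H.domain
    · rw [dif_pos hy, norm_inner_symm y, ← inner_apply_left hH x ⟨y, hy⟩]
    · rw [dif_neg hy, dif_pos x.2, norm_inner_symm y]

/-- The eigenbasis is arbitrary because `fisherInformation` chooses one. In any of them a single
$b_k$ is $x$ up to a phase, with eigenvalue $1$, and all other eigenvalues vanish. Only the pairs
$(k,j)$ and $(j,k)$ with $j\ne k$ count, with weight $1$; by Parseval each kind sums to the
variance. -/
theorem fisherSum_eq {H : E →ₗ.[ℂ] E} (hH : IsSelfAdjoint H) {x : H.domain}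
    (hx : ‖(x : E)‖ = 1) {ι : Type*} (b : HilbertBasis ι ℂ E) (l : ι → ℝ)
    (hl : ∀ i, (pureState (x : E) : E →L[ℂ] E) (b i) = (l i : ℂ) • b i) :
    fisherSum H b l = 4 * variance H x := by
  classical
  simp only [coe_pureState_apply] at hl
  obtain ⟨k, hk⟩ : ∃ k, (inner ℂ (b k) (x : E) : ℂ) ≠ 0 := by
    by_contra! h
    have h1 := hasSum_norm_inner_sq b (x : E)
    simp only [h, hx, norm_zero] at h1
    have h2 : HasSum (fun _ : ι => (0 : ℝ) ^ 2) 0 := by simp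
    simpa using h1.unique h2
  have hb1 : ∀ i, ‖b i‖ = 1 := b.orthonormal.1
  have hk' : (inner ℂ (x : E) (b k) : ℂ) ≠ 0 := fun h => hk (inner_eq_zero_symm.1 h)
  have hlk0 : (l k : ℂ) ≠ 0 := fun h => by
    have h1 := hl k
    rw [h, zero_smul, smul_eq_zero] at h1
    exact h1.elim hk' fun h2 => by simp [h2] at hx
  obtain ⟨z, hz⟩ : ∃ z : ℂ, b k = z • (x : E) :=
    ⟨(l k : ℂ)⁻¹ * inner ℂ (x : E) (b k), by rw [mul_smul, hl, inv_smul_smul₀ hlk0]⟩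
  have hz1 : ‖z‖ = 1 := by
    have := congrArg norm hz
    rwa [norm_smul, hx, mul_one, hb1, eq_comm] at this
  have hlk : l k = 1 := by
    have h1 := hl k
    rw [hz, inner_smul_right, inner_self_eq_norm_sq_to_K, hx, smul_smul] at h1
    have hx0 : (x : E) ≠ 0 := fun h => by simp [h] at hx
    have h2 := smul_left_injective ℂ hx0 h1
    have hz0 : z ≠ 0 := fun h => by simp [h] at hz1
    have h3 : (l k : ℂ) = 1 := by
      refine mul_right_cancel₀ hz0 ?_
      simpa using h2.symm
    exact_mod_cast h3
  have hli : ∀ i, i ≠ k → l i = 0 := fun i hi => by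
    have h1 : (inner ℂ (x : E) (b i) : ℂ) = 0 := by
      have h2 : (inner ℂ (b k) (b i) : ℂ) = 0 := b.orthonormal.2 hi.symm
      rw [hz, inner_smul_left, mul_eq_zero] at h2
      exact h2.resolve_left fun h => by simp [show z = 0 by simpa using h] at hz1
    have h2 := hl i
    rw [h1, zero_smul, eq_comm, smul_eq_zero] at h2
    exact_mod_cast h2.resolve_right fun h => by simpa [h] using hb1 i
  rw [← variance_smul hz1]
  have hy : b k = ((z • x : H.domain) : E) := hz
  generalize z • x = y at hy
  have hm1 : ∀ i, ‖matrixElement H (b i) (b k)‖ = ‖(inner ℂ (b i) (H y) : ℂ)‖ := fun i => by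
    rw [hy]
    exact (norm_matrixElement hH y (b i)).1
  have hm2 : ∀ i, ‖matrixElement H (b k) (b i)‖ = ‖(inner ℂ (b i) (H y) : ℂ)‖ := fun i => by
    rw [hy]
    exact (norm_matrixElement hH y (b i)).2
  set a : ι → ℝ := fun i => if i = k then 0 else ‖(inner ℂ (b i) (H y) : ℂ)‖ ^ 2 with ha
  have hsum : HasSum a (variance H y) := by
    rw [variance_eq_norm_sq_sub hH, ← hy]
    refine ((hasSum_norm_inner_sq b (H y)).sub
      (hasSum_ite_eq k (‖(inner ℂ (b k) (H y) : ℂ)‖ ^ 2))).congr_fun fun i => ?_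
    by_cases hi : i = k
    · simp [ha, hi]
    · simp [ha, hi]
  have h1 : HasSum (fun p : ι × ι => if p.1 = k then a p.2 else 0) (variance H y) := by
    rw [← (Prod.mk_right_injective k).hasSum_iff]
    · simpa [Function.comp_def] using hsum
    · rintro ⟨i, j⟩ hij
      exact if_neg fun h => hij ⟨j, by simpa using h.symm⟩
  have h2 : HasSum (fun p : ι × ι => if p.2 = k then a p.1 else 0) (variance H y) := by
    rw [← (Prod.mk_left_injective k).hasSum_iff]
    · simpa [Function.comp_def] using hsum
    · rintro ⟨i, j⟩ hij
      exact if_neg fun h => hij ⟨i, by simpa using h.symm⟩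
  have h3 : HasSum (fun p : ι × ι => (l p.1 - l p.2) ^ 2 / (l p.1 + l p.2) *
      ‖matrixElement H (b p.1) (b p.2)‖ ^ 2) (variance H y + variance H y) := by
    refine (h1.add h2).congr_fun ?_
    rintro ⟨i, j⟩
    by_cases hi : i = k <;> by_cases hj : j = k
    · simp [hi, hj, ha]
    · simp [hi, hj, ha, hli, hlk, hm2]
    · simp [hi, hj, ha, hli, hlk, hm1]
    -- Both eigenvalues vanish, and the weight $0/0$ is $0$.
    · simp [hi, hj, hli]
  rw [fisherSum, h3.tsum_eq]
  ring

/-- The quantum Fisher information of a pure state is four times its variance. -/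
theorem fisherInformation_pureState {H : E →ₗ.[ℂ] E} (hH : IsSelfAdjoint H) {x : H.domain}
    (hx : ‖(x : E)‖ = 1) :
    fisherInformation (pureState (x : E) : E →L[ℂ] E) H = 4 * variance H x := by
  -- Extending $\{x\}$ to a Hilbert basis rules out the default value $0$.
  have hex : ∃ (w : Set E) (b : HilbertBasis w ℂ E) (l : w → ℝ),
      ∀ i, (pureState (x : E) : E →L[ℂ] E) (b i) = (l i : ℂ) • b i := by
    classical
    have ho : Orthonormal ℂ ((↑) : ({(x : E)} : Set E) → E) := by
      refine ⟨fun i => ?_, fun i j hij => (hij (Subsingleton.elim i j)).elim⟩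
      rw [Set.mem_singleton_iff.1 i.2, hx]
    obtain ⟨w, b, hw, hb⟩ := ho.exists_hilbertBasis_extension
    have hxw : (x : E) ∈ w := hw rfl
    refine ⟨w, b, fun i => if i = ⟨x, hxw⟩ then 1 else 0, fun i => ?_⟩
    rw [coe_pureState_apply]
    by_cases hi : i = ⟨x, hxw⟩
    · simp [hi, hb, inner_self_eq_norm_sq_to_K, hx]
    · have h := b.orthonormal.2 (Ne.symm hi)
      rw [hb] at h ⊢
      simp only at h
      simp [hi, h]
  rw [fisherInformation, dif_pos hex]
  exact fisherSum_eq hH hx _ _ hex.choose_spec.choose_spec.choose_spec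

end Fisher

/-! ### Scaling limit at time $m^{-1/2}$ -/

section Asymptotics

theorem tendsto_mul_one_sub_survival {g : ℝ → ℝ} {v r : ℝ}
    (hg : Tendsto (fun t => (1 - g t) / t ^ 2) (𝓝[≠] 0) (𝓝 v)) {n : ℕ → ℕ}
    (hn : Tendsto (fun m => (n m : ℝ) / m) atTop (𝓝 r)) :
    Tendsto (fun m : ℕ => n m * (1 - g (√m)⁻¹)) atTop (𝓝 (r * v)) := by
  have ht : Tendsto (fun m : ℕ => (√(m : ℝ))⁻¹) atTop (𝓝[≠] 0) := by
    refine tendsto_nhdsWithin_iff.2 ⟨?_, ?_⟩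
    · exact tendsto_inv_atTop_zero.comp (Real.tendsto_sqrt_atTop.comp tendsto_natCast_atTop_atTop)
    · filter_upwards [eventually_gt_atTop 0] with m hm
      have : (0 : ℝ) < m := by exact_mod_cast hm
      exact inv_ne_zero (Real.sqrt_pos.2 this).ne'
  refine (hn.mul (hg.comp ht)).congr' ?_
  filter_upwards [eventually_gt_atTop 0] with m hm
  have : (0 : ℝ) < m := by exact_mod_cast hm
  rw [Function.comp_apply, inv_pow, Real.sq_sqrt this.le]
  field_simp

end Asymptotics

/-! ### The bound on the conversion rate -/

section Conversion

variable {E : Type u} [NormedAddCommGroup E] [InnerProductSpace ℂ E] [CompleteSpace E]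
variable {F : Type v} [NormedAddCommGroup F] [InnerProductSpace ℂ F] [CompleteSpace F]

theorem AsymptoticallyConvertible.sqrt_one_sub_exp_le {H : E →ₗ.[ℂ] E} (hH : IsSelfAdjoint H)
    {H' : F →ₗ.[ℂ] F} (hH' : IsSelfAdjoint H') {U : ℝ → E ≃ₗᵢ[ℂ] E} {U' : ℝ → F ≃ₗᵢ[ℂ] F}
    (hU : IsTimeEvolution H U) (hU' : IsTimeEvolution H' U') {ψ : H.domain} (hψ : ‖(ψ : E)‖ = 1)
    {φ : H'.domain} (hφ : ‖(φ : F)‖ = 1) {R : ℝ} {n : ℕ → ℕ}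
    (hn : Tendsto (fun m => (n m : ℝ) / m) atTop (𝓝 R))
    (hconv : AsymptoticallyConvertible
      (fun m => pureState (vectorPower (ψ : E) m)) (fun m => iidHamiltonian H m)
      (fun m => pureState (vectorPower (φ : F) (n m))) (fun m => iidHamiltonian H' (n m)))
    {ε : ℝ} (hε : 0 < ε) (hε1 : ε ≤ 1) :
    √(1 - Real.exp (-(R * variance H' φ))) ≤ 4 * ε + √(1 - Real.exp (-variance H ψ)) := by
  obtain ⟨Φ, hΦ, hlim⟩ := hconv ε hε hε1
  set g : ℝ → ℝ := fun t => ‖(inner ℂ (ψ : E) (U t ψ) : ℂ)‖ ^ 2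
  set g' : ℝ → ℝ := fun t => ‖(inner ℂ (φ : F) (U' t φ) : ℂ)‖ ^ 2
  -- A `limsup` of at most `ε` gives no eventual bound by `ε` itself; `2 * ε` leaves room, and
  -- paying it twice gives `4 * ε`.
  have hev : ∀ᶠ m in atTop, traceDist (Φ m (pureState (vectorPower (ψ : E) m)))
      (pureState (vectorPower (φ : F) (n m))) < 2 * ε := by
    refine eventually_lt_of_limsup_lt (hlim.trans_lt (by linarith)) ?_
    exact isBoundedUnder_of ⟨1, fun m => (hΦ m).1.traceDist_pureState_le_one
      (norm_vectorPower hψ m) (norm_vectorPower hφ (n m))⟩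
  have hmono : ∀ᶠ m : ℕ in atTop, √(1 - Real.exp (-(n m * (1 - g' (√m)⁻¹)))) ≤
      4 * ε + √(1 - g (√m)⁻¹ ^ m) := by
    filter_upwards [hev] with m hm
    have h1 := IsCovariant.sqrt_le_add_sqrt (hΦ m).1 (hΦ m).2 (isTimeEvolution_iidEvolution hU m)
      (isTimeEvolution_iidEvolution hU' (n m)) (norm_vectorPower hψ m)
      (norm_vectorPower hφ (n m)) (√m)⁻¹
    rw [norm_inner_iidEvolution_sq, norm_inner_iidEvolution_sq] at h1
    -- On the output side the one-sided bound $x\le e^{-(1-x)}$ is enough, and it handles the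
    -- exponent `n m`. The input side needs the limit of $g^m$.
    have h2 : g' (√m)⁻¹ ^ n m ≤ Real.exp (-(n m * (1 - g' (√m)⁻¹))) := by
      have h3 : g' (√m)⁻¹ ≤ Real.exp (-(1 - g' (√m)⁻¹)) := by
        linarith [Real.add_one_le_exp (-(1 - g' (√m)⁻¹))]
      refine (pow_le_pow_left₀ (sq_nonneg _) h3 _).trans_eq ?_
      rw [← Real.exp_nat_mul, mul_neg]
    have h4 := Real.sqrt_le_sqrt (sub_le_sub_left h2 1)
    exact h4.trans (h1.trans (by linarith))
  have hid : Tendsto (fun m : ℕ => (m : ℝ) / m) atTop (𝓝 1) := by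
    refine tendsto_const_nhds.congr' ?_
    filter_upwards [eventually_gt_atTop 0] with m hm
    rw [div_self (by positivity)]
  have hlim' := tendsto_mul_one_sub_survival (tendsto_survival_div_sq hH' hU' hφ) hn
  have hlim1 := tendsto_mul_one_sub_survival (n := id) (tendsto_survival_div_sq hH hU hψ) hid
  have hpow : Tendsto (fun m : ℕ => g (√m)⁻¹ ^ m) atTop (𝓝 (Real.exp (-variance H ψ))) := by
    have := Real.tendsto_one_add_pow_exp_of_tendsto (g := fun m : ℕ => g (√m)⁻¹ - 1)
      (t := -variance H ψ) (by
        refine (one_mul (variance H ψ) ▸ hlim1.neg).congr fun m => ?_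
        simp only [id, g]
        ring)
    simpa using this
  refine le_of_tendsto_of_tendsto ?_ ?_ hmono
  · exact ((Real.continuous_exp.tendsto _).comp hlim'.neg).const_sub 1 |>.sqrt
  · exact (hpow.const_sub 1).sqrt.const_add (4 * ε)

theorem AsymptoticallyConvertible.mul_variance_le {H : E →ₗ.[ℂ] E} (hH : IsSelfAdjoint H)
    {H' : F →ₗ.[ℂ] F} (hH' : IsSelfAdjoint H') {U : ℝ → E ≃ₗᵢ[ℂ] E} {U' : ℝ → F ≃ₗᵢ[ℂ] F}
    (hU : IsTimeEvolution H U) (hU' : IsTimeEvolution H' U') {ψ : H.domain} (hψ : ‖(ψ : E)‖ = 1)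
    {φ : H'.domain} (hφ : ‖(φ : F)‖ = 1) {R : ℝ} {n : ℕ → ℕ}
    (hn : Tendsto (fun m => (n m : ℝ) / m) atTop (𝓝 R))
    (hconv : AsymptoticallyConvertible
      (fun m => pureState (vectorPower (ψ : E) m)) (fun m => iidHamiltonian H m)
      (fun m => pureState (vectorPower (φ : F) (n m))) (fun m => iidHamiltonian H' (n m))) :
    R * variance H' φ ≤ variance H ψ := by
  have h : √(1 - Real.exp (-(R * variance H' φ))) ≤ √(1 - Real.exp (-variance H ψ)) := by
    refine le_of_forall_pos_le_add fun δ hδ => ?_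
    have := hconv.sqrt_one_sub_exp_le hH hH' hU hU' hψ hφ hn (ε := min (δ / 4) 1)
      (by positivity) (min_le_right _ _)
    linarith [min_le_left (δ / 4) 1]
  -- Real square roots truncate at zero, so cancelling them needs $1-e^{-\mathrm{Var}(\psi)}\ge0$.
  have hv : 0 ≤ variance H ψ := by
    rw [variance_eq_norm_sq hH hψ]
    positivity
  rw [Real.sqrt_le_sqrt_iff (by simpa using hv), sub_le_sub_iff_left, Real.exp_le_exp] at h
  linarith

end Conversion

end Asymmetry

theorem mainTheorem5 {E : Type*} [NormedAddCommGroup E] [InnerProductSpace ℂ E] [CompleteSpace E]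
    {E' : Type*} [NormedAddCommGroup E'] [InnerProductSpace ℂ E'] [CompleteSpace E']
    (H : E →ₗ.[ℂ] E) (hH : IsSelfAdjoint H) (H' : E' →ₗ.[ℂ] E') (hH' : IsSelfAdjoint H')
    (ψ : H.domain) (hψ : ‖(ψ : E)‖ = 1) (hψp : period H (ψ : E) = 2 * Real.pi)
    (φ : H'.domain) (hφ : ‖(φ : E')‖ = 1) (hφp : period H' (φ : E') = 2 * Real.pi)
    (R : ℝ) (hR : 0 < R)
    (hconv : AsymptoticallyConvertible
      (fun m : ℕ => pureState (vectorPower (ψ : E) m))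
      (fun m : ℕ => iidHamiltonian H m)
      (fun m : ℕ => pureState (vectorPower (φ : E') ⌈R * m⌉₊))
      (fun m : ℕ => iidHamiltonian H' ⌈R * m⌉₊)) :
    0 < variance H' φ ∧
    R * variance H' φ ≤ variance H ψ ∧
    0 < fisherInformation (pureState (φ : E') : E' →L[ℂ] E') H' ∧
    R ≤ variance H ψ / variance H' φ ∧
    variance H ψ / variance H' φ =
      fisherInformation (pureState (ψ : E) : E →L[ℂ] E) H /
        fisherInformation (pureState (φ : E') : E' →L[ℂ] E') H' := by
  have hpψ : period H (ψ : E) ≠ 0 := hψp ▸ Real.two_pi_pos.ne'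
  have hpφ : period H' (φ : E') ≠ 0 := hφp ▸ Real.two_pi_pos.ne'
  obtain ⟨U, hU⟩ := exists_isTimeEvolution_of_period_ne_zero hpψ
  obtain ⟨U', hU'⟩ := exists_isTimeEvolution_of_period_ne_zero hpφ
  have hv := variance_pos_of_period_ne_zero hH' hφ hpφ
  have hle : R * variance H' φ ≤ variance H ψ :=
    AsymptoticallyConvertible.mul_variance_le hH hH' hU hU' hψ hφ
      ((tendsto_nat_ceil_mul_div_atTop hR.le).comp
        tendsto_natCast_atTop_atTop) hconv
  rw [fisherInformation_pureState hH hψ, fisherInformation_pureState hH' hφ]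
  exact ⟨hv, hle, by positivity, (le_div_iff₀ hv).2 hle,
    (mul_div_mul_left _ _ four_ne_zero).symm⟩
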